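/- Let $n\ge 0$. Let $B_n$ be the braid group on $n$ strands, with generators $\sigma_1,\dots,\sigma_{n-1}$ and relations $\sigma_i\sigma_{i+1}\sigma_i=\sigma_{i+1}\sigma_i\sigma_{i+1}$ and $\sigma_i\sigma_j=\sigma_j\sigma_i$ for $j>i+1$. Let $SG_n$ be the singular braid group, that is, the group with generators $\sigma_1,\dots,\sigma_{n-1}$ and $\tau_1$ (the latter only if $n\ge 2$) and relations $$\sigma_i\sigma_{i+1}\sigma_i=\sigma_{i+1}\sigma_i\sigma_{i+1},\qquad \sigma_i\sigma_j=\sigma_j\sigma_i\ \ (j>i+1),$$ $$\sigma_2\sigma_1^2\sigma_2\,\tau_1=\tau_1\,\sigma_2\sigma_1^2\sigma_2\ \ (n\ge 3),\qquad \sigma_i\tau_1=\tau_1\sigma_i\ \ (i\ne 2),$$ $$\sigma_2\sigma_3\sigma_1\sigma_2\,\tau_1\,\sigma_2\sigma_3\sigma_1\sigma_2\,\tau_1=\tau_1\,\sigma_2\sigma_3\sigma_1\sigma_2\,\tau_1\,\sigma_2\sigma_3\sigma_1\sigma_2\ \ (n>3).$$ Let $N$ be the normal subgroup of $SG_n$ normally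 generated by $\tau_1\sigma_1^{-1}$ (trivial if $n\le 1$). **Theorem.** The group $SG_n$ is torsion-free: its only element of finite order is the identity. The group $B_n$ is torsion-free as well, and there is an isomorphism $SG_n/N\cong B_n$ that sends the class of $\sigma_i$ to $\sigma_i$ for $1\le i\le n-1$ and the class of $\tau_1$ to $\sigma_1$. -/

import Mathlib

/-- A group is torsion-free if its only element of finite order is the identity.
(Mathlib's `IsMulTorsionFree` asks for uniqueness of roots, which is strictly stronger for
non-commutative groups and fails for braid groups.) -/
def TorsionFreeGroup (G : Type*) [Group G] : Prop :=
  ∀ g : G, IsOfFinOrder g → g = 1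

/-- The index set `{1, …, n - 1}` of the elementary braids on `n` strands. -/
abbrev BraidIndex (n : ℕ) : Type := Set.Ico 1 n

/-- Defining relations `u = v` of the braid group on `n` strands. -/
inductive BraidRel (n : ℕ) : FreeGroup (BraidIndex n) → FreeGroup (BraidIndex n) → Prop
  /-- `σ_i σ_{i+1} σ_i = σ_{i+1} σ_i σ_{i+1}` -/
  | braid (i j : BraidIndex n) (h : (j : ℕ) = i + 1) :
      BraidRel n (.of i * .of j * .of i) (.of j * .of i * .of j)
  /-- `σ_i σ_j = σ_j σ_i` for `j > i + 1` -/
  | comm (i j : BraidIndex n) (h : (j : ℕ) > i + 1) :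
      BraidRel n (.of i * .of j) (.of j * .of i)

/-- The braid group `B_n` on `n` strands, by Artin's presentation. -/
abbrev BraidGroup (n : ℕ) : Type :=
  PresentedGroup {r : FreeGroup (BraidIndex n) | ∃ u v, BraidRel n u v ∧ r = u * v⁻¹}

namespace BraidGroup

/-- The elementary braid `σ_i` in `B_n`. -/
def sigma {n : ℕ} (i : BraidIndex n) : BraidGroup n := PresentedGroup.of i

end BraidGroup

/-- Generators of the singular braid group on `n` strands: `σ_1, …, σ_{n-1}` and `τ_1`;
the latter is present only if there are at least two strands. -/
inductive SingularBraidGen (n : ℕ) : Type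
  | sigma (i : BraidIndex n)
  | tau (h : 1 < n)

namespace SingularBraidGen

/-- The letter `σ_i` in the free group on the generators. -/
abbrev s {n : ℕ} (i : ℕ) (hi : 1 ≤ i) (hin : i < n) : FreeGroup (SingularBraidGen n) :=
  .of (.sigma ⟨i, hi, hin⟩)

/-- The letter `τ_1` in the free group on the generators. -/
abbrev t {n : ℕ} (h : 1 < n) : FreeGroup (SingularBraidGen n) := .of (.tau h)

/-- The word `σ_2 σ_1² σ_2`, for `n ≥ 3`. -/
abbrev wordA {n : ℕ} (h : 2 < n) : FreeGroup (SingularBraidGen n) :=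
  s 2 (by omega) h * s 1 (by omega) (by omega) ^ 2 * s 2 (by omega) h

/-- The word `σ_2 σ_3 σ_1 σ_2`, for `n > 3`. -/
abbrev wordB {n : ℕ} (h : 3 < n) : FreeGroup (SingularBraidGen n) :=
  s 2 (by omega) (by omega) * s 3 (by omega) h * s 1 (by omega) (by omega) *
    s 2 (by omega) (by omega)

end SingularBraidGen

open SingularBraidGen in
/-- Defining relations `u = v` of the singular braid monoid `SB_n`, read in the free group. The
relations `σ_i σ_i⁻¹ = 1` hold there automatically. -/
inductive SingularBraidRel (n : ℕ) :
    FreeGroup (SingularBraidGen n) → FreeGroup (SingularBraidGen n) → Prop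
  /-- `σ_i σ_{i+1} σ_i = σ_{i+1} σ_i σ_{i+1}` -/
  | braid (i j : BraidIndex n) (h : (j : ℕ) = i + 1) :
      SingularBraidRel n
        (.of (.sigma i) * .of (.sigma j) * .of (.sigma i))
        (.of (.sigma j) * .of (.sigma i) * .of (.sigma j))
  /-- `σ_i σ_j = σ_j σ_i` for `j > i + 1` -/
  | comm (i j : BraidIndex n) (h : (j : ℕ) > i + 1) :
      SingularBraidRel n
        (.of (.sigma i) * .of (.sigma j))
        (.of (.sigma j) * .of (.sigma i))
  /-- `σ_2 σ_1² σ_2 τ_1 = τ_1 σ_2 σ_1² σ_2` -/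
  | tau_wordA (h : 2 < n) :
      SingularBraidRel n (wordA h * t (by omega)) (t (by omega) * wordA h)
  /-- `σ_i τ_1 = τ_1 σ_i` for `i ≠ 2` -/
  | tau_sigma (h : 1 < n) (i : BraidIndex n) (hi : (i : ℕ) ≠ 2) :
      SingularBraidRel n (.of (.sigma i) * t h) (t h * .of (.sigma i))
  /-- `σ_2 σ_3 σ_1 σ_2 τ_1 σ_2 σ_3 σ_1 σ_2 τ_1 = τ_1 σ_2 σ_3 σ_1 σ_2 τ_1 σ_2 σ_3 σ_1 σ_2`
  for `n > 3` -/
  | tau_wordB (h : 3 < n) :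
      SingularBraidRel n
        (wordB h * t (by omega) * wordB h * t (by omega))
        (t (by omega) * wordB h * t (by omega) * wordB h)

/-- The singular braid group `SG_n` on `n` strands: the group given by the presentation of the
singular braid monoid `SB_n`. -/
abbrev SingularBraidGroup (n : ℕ) : Type :=
  PresentedGroup
    {r : FreeGroup (SingularBraidGen n) | ∃ u v, SingularBraidRel n u v ∧ r = u * v⁻¹}

namespace SingularBraidGroup

/-- The elementary braid `σ_i` in `SG_n`. -/
def sigma {n : ℕ} (i : BraidIndex n) : SingularBraidGroup n := PresentedGroup.of (.sigma i)

/-- The elementary singular braid `τ_1` in `SG_n`, for `n ≥ 2`. -/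
def tauOne {n : ℕ} (h : 1 < n) : SingularBraidGroup n := PresentedGroup.of (.tau h)

/-- The subgroup `N` of `SG_n` normally generated by `τ_1 σ_1⁻¹`
(the trivial subgroup if `n ≤ 1`). -/
abbrev N (n : ℕ) : Subgroup (SingularBraidGroup n) :=
  Subgroup.normalClosure
    {g | ∃ h : 1 < n, g = tauOne h * (sigma ⟨1, le_rfl, h⟩)⁻¹}

end SingularBraidGroup

/-!
Both groups are shown to be torsion-free by elementary means.

*Braid groups.* The monoid of positive braids is left cancellative, and two of its elements with a
common right multiple have a least one. Both facts follow from Garside's property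
(`ArtinMonoid.garside`): an element that starts with `σ_i` and with `σ_j` starts with the least
common multiple of the two. It is proved by induction on the length for the Artin monoid of any
triangle-free graph, by describing equality of two words through their heads and tails; the point
is that this description is transitive (`ArtinMonoid.GarsideBelow.cube`). The full twist
`z = (σ_1 ⋯ σ_{n-1}) ^ n` is central and is divided by all generators, so every element divides a
power of `z`; hence all least common multiples exist, and the positive monoid embeds in the braid
group, where every element becomes positive after multiplication by a power of `z`. Left
translation by an element `g` of finite order permutes the powers of `g`, therefore it fixes their
least common multiple, and `g = 1` (`torsionFreeGroup_of_lcm`).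

*Singular braid groups.* Let `t = τ_1 σ_1⁻¹`. In terms of the `σ_i` and `t`, the relations that
involve `τ_1` all say that `t` commutes with certain braids and with one of its own conjugates
(`wordB_relation_iff`). Let `K` be the right-angled Artin group with a generator `x_e` for every
element `e` of `SG_n`, where `x_e` and `x_f` commute if `e` and `f` do; braids act on it by
conjugation of the indices. Then `σ_i ↦ σ_i`, `τ_1 ↦ x_t σ_1` defines a homomorphism from `SG_n` to
the semidirect product of `K` and `B_n`, and `x_e ↦ e` shows that it is injective. So `SG_n` is
torsion-free because `K` and `B_n` are.

*Right-angled Artin groups.* The same device, applied to one generator `v` and with a free group in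
place of `K`, shows that the kernel of the endomorphism that kills `v` embeds in a free group.
Induction on the number of generators that occur in an element then shows that right-angled Artin
groups are torsion-free (`RightAngledArtinGroup.torsionFreeGroup`).
-/

open scoped commutatorElement

/-! ### Torsion in extensions and right-angled Artin groups -/

theorem TorsionFreeGroup.of_injective {G H : Type*} [Group G] [Group H] (hH : TorsionFreeGroup H)
    (f : G →* H) (hf : Function.Injective f) : TorsionFreeGroup G := fun g hg ↦
  hf (by rw [hH _ (f.isOfFinOrder hg), map_one])

/-- The group generated by the elements of `V`, where `a` and `b` are made to commute whenever
`R a b` holds; `R` need be neither symmetric nor irreflexive. -/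
abbrev RightAngledArtinGroup {V : Type*} (R : V → V → Prop) : Type _ :=
  PresentedGroup {r : FreeGroup V | ∃ a b, R a b ∧ r = ⁅FreeGroup.of a, FreeGroup.of b⁆}

namespace RightAngledArtinGroup

variable {V W : Type*} {R : V → V → Prop} {S : W → W → Prop} {G : Type*} [Group G]

/-- The generator attached to a vertex. -/
def of (R : V → V → Prop) (v : V) : RightAngledArtinGroup R := PresentedGroup.of v

theorem commute_of {a b : V} (h : R a b) : Commute (of R a) (of R b) := by
  rw [← commutatorElement_eq_one_iff_commute]
  have := PresentedGroup.one_of_mem (rels := {r : FreeGroup V | ∃ a b, R a b ∧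
    r = ⁅FreeGroup.of a, FreeGroup.of b⁆}) ⟨a, b, h, rfl⟩
  rwa [map_commutatorElement] at this

/-- The homomorphism determined by the images of the generators. -/
def lift (f : V → G) (hf : ∀ a b, R a b → Commute (f a) (f b)) : RightAngledArtinGroup R →* G :=
  PresentedGroup.toGroup (f := f) (by
    rintro _ ⟨a, b, h, rfl⟩
    rw [map_commutatorElement, commutatorElement_eq_one_iff_commute]
    simpa using hf a b h)

@[simp]
theorem lift_of (f : V → G) (hf : ∀ a b, R a b → Commute (f a) (f b)) (v : V) :
    lift f hf (of R v) = f v :=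
  PresentedGroup.toGroup.of _

@[ext]
theorem hom_ext {f g : RightAngledArtinGroup R →* G} (h : ∀ v, f (of R v) = g (of R v)) : f = g :=
  PresentedGroup.ext h

/-- The action of a group on the right-angled Artin group of a relation on the group itself which
is invariant under conjugation. -/
def conj (R : G → G → Prop) (hR : ∀ g a b, R a b → R (g * a * g⁻¹) (g * b * g⁻¹)) :
    G →* MulAut (RightAngledArtinGroup R) where
  toFun g :=
    MonoidHom.toMulEquiv
      (lift (fun a ↦ of R (g * a * g⁻¹)) fun _ _ h ↦ commute_of (hR g _ _ h))
      (lift (fun a ↦ of R (g⁻¹ * a * g⁻¹⁻¹)) fun _ _ h ↦ commute_of (hR g⁻¹ _ _ h))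
      (by ext; simp [mul_assoc]) (by ext; simp [mul_assoc])
  map_one' := by
    apply MulEquiv.toMonoidHom_injective
    ext; simp [MonoidHom.toMulEquiv]
  map_mul' g h := by
    apply MulEquiv.toMonoidHom_injective
    ext; simp [MonoidHom.toMulEquiv, mul_assoc]

@[simp]
theorem conj_of (R : G → G → Prop) (hR : ∀ g a b, R a b → R (g * a * g⁻¹) (g * b * g⁻¹)) (g a : G) :
    conj R hR g (of R a) = of R (g * a * g⁻¹) :=
  lift_of (fun a ↦ of R (g * a * g⁻¹)) (fun _ _ h ↦ commute_of (hR g _ _ h)) a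

/-- The evaluation map of a semidirect product with a right-angled Artin group, on which the right
factor acts by conjugation. -/
def evalSemidirect {E B : Type*} [Group E] [Group B] {R : E → E → Prop}
    (hR : ∀ g a b, R a b → R (g * a * g⁻¹) (g * b * g⁻¹)) (hcomm : ∀ a b, R a b → Commute a b)
    (s : B →* E) : RightAngledArtinGroup R ⋊[(conj R hR).comp s] B →* E :=
  SemidirectProduct.lift (lift id hcomm) s (fun b ↦ by ext; simp)

theorem evalSemidirect_apply {E B : Type*} [Group E] [Group B] {R : E → E → Prop}
    (hR : ∀ g a b, R a b → R (g * a * g⁻¹) (g * b * g⁻¹)) (hcomm : ∀ a b, R a b → Commute a b)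
    (s : B →* E) (x : RightAngledArtinGroup R ⋊[(conj R hR).comp s] B) :
    evalSemidirect hR hcomm s x = lift id hcomm x.left * s x.right := rfl

/-- Let `s : B →* E` be a homomorphism of groups, and let `B` act through `s`, by conjugation, on
the right-angled Artin group of a relation on `E` that implies commutation. If
`f : E →* RightAngledArtinGroup R ⋊ B` is a section of the evaluation map, then torsion elements of
`E` are detected by their components in `B`. -/
theorem eq_one_of_right_eq_one {E B : Type*} [Group E] [Group B] {R : E → E → Prop}
    (hR : ∀ g a b, R a b → R (g * a * g⁻¹) (g * b * g⁻¹)) (hcomm : ∀ a b, R a b → Commute a b)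
    (htf : TorsionFreeGroup (RightAngledArtinGroup R)) (s : B →* E)
    (f : E →* RightAngledArtinGroup R ⋊[(conj R hR).comp s] B)
    (hf : ∀ e, evalSemidirect hR hcomm s (f e) = e)
    {e : E} (he : IsOfFinOrder e) (h1 : (f e).right = 1) : e = 1 := by
  have hl : SemidirectProduct.inl (f e).left = f e := by
    ext <;> simp [h1]
  have hfin : IsOfFinOrder (f e).left := by
    rw [← SemidirectProduct.inl_injective.isOfFinOrder_iff
      (f := (SemidirectProduct.inl : _ →* RightAngledArtinGroup R ⋊[(conj R hR).comp s] B)), hl]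
    exact f.isOfFinOrder he
  rw [← hf e, evalSemidirect_apply, h1, htf _ hfin]
  simp

/-- Without commutation relations, the group is free. -/
theorem torsionFreeGroup_of_false {V : Type*} :
    TorsionFreeGroup (RightAngledArtinGroup fun _ _ : V ↦ False) := by
  have hfree : TorsionFreeGroup (FreeGroup V) := fun _ h ↦ h.eq_one'
  refine hfree.of_injective (lift FreeGroup.of fun _ _ h ↦ h.elim) ?_
  have : (FreeGroup.lift (of fun _ _ : V ↦ False)).comp (lift FreeGroup.of fun _ _ h ↦ h.elim) =
      MonoidHom.id _ := by
    ext; simp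
  exact Function.LeftInverse.injective (g := FreeGroup.lift (of fun _ _ : V ↦ False))
    (DFunLike.congr_fun this)

open Classical in
/-- The endomorphism that sends one generator to `1` and fixes the others. -/
noncomputable def kill (R : V → V → Prop) (v : V) :
    RightAngledArtinGroup R →* RightAngledArtinGroup R :=
  lift (fun w ↦ if w = v then 1 else of R w) fun a b h ↦ by
    by_cases ha : a = v <;> by_cases hb : b = v <;> simp [ha, hb, commute_of h]

/-- The kernel of `kill R v` is torsion-free: it embeds in the free group on the set of all
elements, each conjugate of the generator `v` being sent to the basis element that it labels. -/
theorem eq_one_of_kill_eq_one (v : V) {a : RightAngledArtinGroup R} (ha : IsOfFinOrder a)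
    (h : kill R v a = 1) : a = 1 := by
  classical
  let F : RightAngledArtinGroup R → RightAngledArtinGroup R → Prop := fun _ _ ↦ False
  have hF : ∀ g a b, F a b → F (g * a * g⁻¹) (g * b * g⁻¹) := fun _ _ _ h ↦ h
  have hc : ∀ a b, F a b → Commute a b := fun _ _ h ↦ h.elim
  let P := RightAngledArtinGroup F ⋊[(conj F hF).comp (MonoidHom.id _)] RightAngledArtinGroup R
  let x : P := SemidirectProduct.inl (of F (of R v))
  have key : ∀ w, Commute (of R w) (of R v) →
      Commute (SemidirectProduct.inr (of R w) : P) x := by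
    intro w hw
    have h1 : of R w * of R v * (of R w)⁻¹ = of R v := by
      rw [hw.eq, mul_inv_cancel_right]
    change SemidirectProduct.inr _ * SemidirectProduct.inl _ =
      SemidirectProduct.inl _ * SemidirectProduct.inr _
    ext <;> simp [h1]
  let f : RightAngledArtinGroup R →* P :=
    lift (fun w ↦ if w = v then x else SemidirectProduct.inr (of R w)) fun a b hab ↦ by
      by_cases ha : a = v <;> by_cases hb : b = v
      · simp [ha, hb]
      · subst ha; simpa [hb] using (key b (commute_of hab).symm).symm
      · subst hb; simpa [ha] using key a (commute_of hab)
      · simpa [ha, hb] using (commute_of hab).map (SemidirectProduct.inr : _ →* P)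
  have hsec : (evalSemidirect hF hc (MonoidHom.id _)).comp f = MonoidHom.id _ := by
    ext w
    by_cases hw : w = v <;> simp [f, hw, x, evalSemidirect_apply]
  have hright : (SemidirectProduct.rightHom).comp f = kill R v := by
    ext w
    by_cases hw : w = v <;> simp [f, hw, x, kill]
  refine eq_one_of_right_eq_one hF hc torsionFreeGroup_of_false (MonoidHom.id _) f
    (fun e ↦ DFunLike.congr_fun hsec e) ha ?_
  rw [← h, ← hright]
  rfl

theorem exists_finset_mem_closure (a : RightAngledArtinGroup R) :
    ∃ S : Finset V, a ∈ Subgroup.closure (of R '' S) := by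
  classical
  have mono : ∀ {S T : Finset V}, S ⊆ T →
      Subgroup.closure (of R '' S) ≤ Subgroup.closure (of R '' T) := fun h ↦
    Subgroup.closure_mono (Set.image_mono (by exact_mod_cast h))
  have ha : a ∈ Subgroup.closure (Set.range (of R)) := by
    have := PresentedGroup.closure_range_of {r : FreeGroup V | ∃ a b, R a b ∧
      r = ⁅FreeGroup.of a, FreeGroup.of b⁆}
    change Subgroup.closure (Set.range (of R)) = ⊤ at this
    rw [this]; trivial
  induction ha using Subgroup.closure_induction with
  | mem x hx =>
    obtain ⟨v, rfl⟩ := hx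
    exact ⟨{v}, Subgroup.subset_closure ⟨v, by simp, rfl⟩⟩
  | one => exact ⟨∅, one_mem _⟩
  | mul x y _ _ hx hy =>
    obtain ⟨S, hS⟩ := hx
    obtain ⟨T, hT⟩ := hy
    exact ⟨S ∪ T, mul_mem (mono Finset.subset_union_left hS) (mono Finset.subset_union_right hT)⟩
  | inv x _ hx =>
    obtain ⟨S, hS⟩ := hx
    exact ⟨S, inv_mem hS⟩

/-- Induction on the number of generators that occur in an element. -/
theorem torsionFreeGroup (R : V → V → Prop) : TorsionFreeGroup (RightAngledArtinGroup R) := by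
  classical
  suffices h : ∀ (S : Finset V) (a : RightAngledArtinGroup R),
      a ∈ Subgroup.closure (of R '' S) → IsOfFinOrder a → a = 1 by
    intro a ha
    obtain ⟨S, hS⟩ := exists_finset_mem_closure a
    exact h S a hS ha
  intro S
  induction S using Finset.induction_on with
  | empty =>
    intro a ha _
    simpa using ha
  | insert v S _ ih =>
    intro a ha hfin
    refine eq_one_of_kill_eq_one v hfin (ih _ ?_ ((kill R v).isOfFinOrder hfin))
    have hle : Subgroup.closure (of R '' (insert v S : Finset V)) ≤
        (Subgroup.closure (of R '' S)).comap (kill R v) := by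
      rw [Subgroup.closure_le]
      rintro _ ⟨w, hw, rfl⟩
      by_cases hwv : w = v
      · simp [kill, hwv]
      · have hwS : w ∈ S := by simpa [hwv] using hw
        simpa [kill, hwv] using Subgroup.subset_closure (Set.mem_image_of_mem (of R) hwS)
    exact hle ha

end RightAngledArtinGroup

/-! ### Artin monoids of triangle-free graphs -/

/-- The defining relations of the Artin monoid of a graph: adjacent generators satisfy the braid
relation, other generators commute. -/
inductive ArtinRel {ι : Type*} (Γ : SimpleGraph ι) : FreeMonoid ι → FreeMonoid ι → Prop
  | braid (i j : ι) (h : Γ.Adj i j) :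
      ArtinRel Γ (.of i * .of j * .of i) (.of j * .of i * .of j)
  | comm (i j : ι) (h : ¬ Γ.Adj i j) : ArtinRel Γ (.of i * .of j) (.of j * .of i)

/-- The Artin monoid of a graph. -/
abbrev ArtinMonoid {ι : Type*} (Γ : SimpleGraph ι) : Type _ := PresentedMonoid (ArtinRel Γ)

namespace ArtinMonoid

variable {ι : Type*} {Γ : SimpleGraph ι}

/-- A generator of the Artin monoid. -/
def gen (Γ : SimpleGraph ι) (i : ι) : ArtinMonoid Γ := PresentedMonoid.of _ i

local notation "s" => gen Γ

theorem gen_braid {i j : ι} (h : Γ.Adj i j) : s i * s j * s i = s j * s i * s j :=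
  PresentedMonoid.mk_eq_mk_of_rel (ArtinRel.braid i j h)

theorem gen_comm {i j : ι} (h : ¬ Γ.Adj i j) : s i * s j = s j * s i :=
  PresentedMonoid.mk_eq_mk_of_rel (ArtinRel.comm i j h)

theorem gen_braid_assoc {i j : ι} (h : Γ.Adj i j) (x : ArtinMonoid Γ) :
    s i * (s j * (s i * x)) = s j * (s i * (s j * x)) := by
  simp only [← mul_assoc, gen_braid h]

theorem gen_comm_assoc {i j : ι} (h : ¬ Γ.Adj i j) (x : ArtinMonoid Γ) :
    s i * (s j * x) = s j * (s i * x) := by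
  simp only [← mul_assoc, gen_comm h]

/-- The homomorphism that sends every generator to `1 : ℕ`, written multiplicatively. -/
def lenHom (Γ : SimpleGraph ι) : ArtinMonoid Γ →* Multiplicative ℕ :=
  PresentedMonoid.lift (fun _ ↦ Multiplicative.ofAdd 1) (by
    rintro _ _ (⟨i, j, h⟩ | ⟨i, j, h⟩) <;> simp)

/-- The length of an element, as a word in the generators. -/
def len (a : ArtinMonoid Γ) : ℕ := Multiplicative.toAdd (lenHom Γ a)

@[simp] theorem len_one : len (1 : ArtinMonoid Γ) = 0 := by simp [len]

@[simp] theorem len_mul (a b : ArtinMonoid Γ) : len (a * b) = len a + len b := by simp [len]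

@[simp] theorem len_gen (i : ι) : len (s i) = 1 := rfl

/-- The class of a word. -/
def word (Γ : SimpleGraph ι) (X : List ι) : ArtinMonoid Γ :=
  PresentedMonoid.mk (ArtinRel Γ) (FreeMonoid.ofList X)

@[simp] theorem word_nil : word Γ [] = 1 := rfl

@[simp] theorem word_cons (i : ι) (X : List ι) : word Γ (i :: X) = s i * word Γ X := rfl

@[simp] theorem word_append (X Y : List ι) : word Γ (X ++ Y) = word Γ X * word Γ Y := rfl

@[simp] theorem len_word (X : List ι) : len (word Γ X) = X.length := by
  induction X with
  | nil => simp
  | cons i X ih => simp [ih, add_comm]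

theorem exists_word (a : ArtinMonoid Γ) : ∃ X, word Γ X = a :=
  let ⟨X, hX⟩ := PresentedMonoid.surjective_mk a
  ⟨X.toList, hX⟩

theorem eq_one_of_len_eq_zero {a : ArtinMonoid Γ} (h : len a = 0) : a = 1 := by
  obtain ⟨X, rfl⟩ := exists_word a
  rw [len_word, List.length_eq_zero_iff] at h
  rw [h, word_nil]

theorem eq_one_or_exists_gen_mul (a : ArtinMonoid Γ) : a = 1 ∨ ∃ i b, a = s i * b := by
  obtain ⟨_ | ⟨i, X⟩, rfl⟩ := exists_word a
  · exact .inl rfl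
  · exact .inr ⟨i, word Γ X, rfl⟩

open Classical in
/-- The right complement of two generators: `s i * compl i j = s j * compl j i` is the shortest
common right multiple of `s i` and `s j`. -/
noncomputable def compl (Γ : SimpleGraph ι) (i j : ι) : ArtinMonoid Γ :=
  if i = j then 1 else if Γ.Adj i j then gen Γ j * gen Γ i else gen Γ j

@[simp] theorem compl_self (i : ι) : compl Γ i i = 1 := by simp [compl]

theorem compl_of_adj {i j : ι} (h : Γ.Adj i j) : compl Γ i j = s j * s i := by
  simp [compl, h, h.ne]

theorem compl_of_not_adj {i j : ι} (hij : i ≠ j) (h : ¬ Γ.Adj i j) : compl Γ i j = s j := by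
  simp [compl, h, hij]

theorem gen_mul_compl (i j : ι) : s i * compl Γ i j = s j * compl Γ j i := by
  by_cases hij : i = j
  · simp [hij]
  by_cases h : Γ.Adj i j
  · rw [compl_of_adj h, compl_of_adj h.symm, ← mul_assoc, ← mul_assoc, gen_braid h]
  · rw [compl_of_not_adj hij h, compl_of_not_adj (Ne.symm hij) (fun h' ↦ h h'.symm), gen_comm h]

/-- Garside's property for elements of length less than `n`: if two elements of length less than `n`
complete `s i` and `s j` to the same element, then that element is a right multiple of the
shortest common right multiple of `s i` and `s j`. -/
def GarsideBelow (Γ : SimpleGraph ι) (n : ℕ) : Prop :=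
  ∀ i j a b, len a < n → gen Γ i * a = gen Γ j * b → ∃ c, a = compl Γ i j * c ∧ b = compl Γ j i * c

namespace GarsideBelow

variable {n : ℕ} (G : GarsideBelow Γ n) {i j k : ι} {a b u v : ArtinMonoid Γ}

include G

theorem cancel (ha : len a < n) (h : s i * a = s i * b) : a = b := by
  obtain ⟨c, rfl, rfl⟩ := G i i a b ha h
  rfl

theorem of_adj (hij : Γ.Adj i j) (ha : len a < n) (h : s i * a = s j * b) :
    ∃ c, a = s j * (s i * c) ∧ b = s i * (s j * c) := by
  obtain ⟨c, rfl, rfl⟩ := G i j a b ha h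
  exact ⟨c, by rw [compl_of_adj hij, mul_assoc], by rw [compl_of_adj hij.symm, mul_assoc]⟩

theorem of_not_adj (hne : i ≠ j) (hij : ¬ Γ.Adj i j) (ha : len a < n) (h : s i * a = s j * b) :
    ∃ c, a = s j * c ∧ b = s i * c := by
  obtain ⟨c, rfl, rfl⟩ := G i j a b ha h
  exact ⟨c, by rw [compl_of_not_adj hne hij],
    by rw [compl_of_not_adj hne.symm (fun h ↦ hij h.symm)]⟩

/-- The cube condition for a generator `k` adjacent to only one of two commuting generators. -/
theorem cube_edge (hij : i ≠ j) (hkj : k ≠ j) (aij : ¬ Γ.Adj i j) (aik : Γ.Adj i k)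
    (akj : ¬ Γ.Adj k j) (hl : len u + 2 ≤ n) (h : s i * (s k * u) = s j * v) :
    ∃ z, s k * (s i * u) = s j * z ∧ s k * v = s i * z := by
  obtain ⟨z, h1, rfl⟩ := G.of_not_adj hij aij (by simp; omega) h
  obtain ⟨w, rfl, rfl⟩ := G.of_not_adj hkj akj (by omega) h1
  refine ⟨s k * (s i * w), ?_, ?_⟩
  · rw [gen_comm_assoc aij, gen_comm_assoc akj]
  · rw [gen_braid_assoc aik]

/-- The cube condition along a path `k`, `i`, `j`. -/
theorem cube_path_end (hkj : k ≠ j) (aij : Γ.Adj i j) (aik : Γ.Adj i k)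
    (akj : ¬ Γ.Adj k j) (hl : len u + 2 ≤ n) (h : s i * (s k * u) = s j * v) :
    ∃ z, s k * (s i * u) = s j * (s i * z) ∧ s k * v = s i * (s j * z) := by
  obtain ⟨p, h1, rfl⟩ := G.of_adj aij (by simp; omega) h
  obtain ⟨q, rfl, h2⟩ := G.of_not_adj hkj akj (by omega) h1
  have hlen := congrArg len h2
  simp only [len_mul, len_gen] at hl hlen
  obtain ⟨r, rfl, rfl⟩ := G.of_adj aik (by omega) h2
  refine ⟨s k * (s i * (s j * r)), ?_, ?_⟩
  · rw [gen_braid_assoc aij, gen_comm_assoc akj, ← gen_comm_assoc akj r, gen_braid_assoc aik.symm]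
  · rw [← gen_comm_assoc akj, gen_braid_assoc aik.symm, gen_braid_assoc aij, gen_comm_assoc akj]

/-- The cube condition along a path `i`, `k`, `j`. -/
theorem cube_path_middle (hij : i ≠ j) (aij : ¬ Γ.Adj i j) (aik : Γ.Adj i k)
    (akj : Γ.Adj k j) (hl : len u + 2 ≤ n) (h : s i * (s k * u) = s j * (s k * v)) :
    ∃ z, s k * (s i * u) = s j * z ∧ s k * (s j * v) = s i * z := by
  have hlen0 := congrArg len h
  simp only [len_mul, len_gen] at hlen0
  obtain ⟨z, h1, h2⟩ := G.of_not_adj hij aij (by simp; omega) h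
  obtain ⟨p, rfl, rfl⟩ := G.of_adj akj (by omega) h1
  obtain ⟨q, rfl, h3⟩ := G.of_adj aik.symm (by omega) h2
  simp only [len_mul, len_gen] at hl hlen0
  have h4 := G.cancel (by simp; omega) h3
  obtain ⟨r, rfl, rfl⟩ := G.of_not_adj hij.symm (fun h ↦ aij h.symm) (by omega) h4
  refine ⟨s k * (s j * (s i * (s k * r))), ?_, ?_⟩
  · rw [gen_comm_assoc aij, gen_braid_assoc aik, gen_braid_assoc akj]
  · rw [← gen_comm_assoc aij, gen_braid_assoc akj.symm, ← gen_comm_assoc aij,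
      gen_braid_assoc aik.symm]

/-- The cube condition: it makes the description of equal words by their heads and tails transitive.
Triangles are excluded because three pairwise adjacent generators have no common multiple. -/
theorem cube (hΓ : ∀ i j k, Γ.Adj i j → Γ.Adj j k → ¬ Γ.Adj i k)
    (h : compl Γ k i * u = compl Γ k j * v) (hl : len (compl Γ k i * u) ≤ n) :
    ∃ z, compl Γ i k * u = compl Γ i j * z ∧ compl Γ j k * v = compl Γ j i * z := by
  have hlen := congrArg len h
  by_cases hki : k = i
  · subst hki
    exact ⟨v, by simpa using h, rfl⟩
  by_cases hkj : k = j
  · subst hkj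
    exact ⟨u, rfl, by simpa using h.symm⟩
  by_cases hij : i = j
  · subst hij
    suffices u = v from ⟨compl Γ i k * u, by simp, by simp [this]⟩
    by_cases aki : Γ.Adj k i
    · simp only [compl_of_adj aki, mul_assoc, len_mul, len_gen] at h hl
      exact G.cancel (by omega) (G.cancel (by simp; omega) h)
    · simp only [compl_of_not_adj hki aki, len_mul, len_gen] at h hl
      exact G.cancel (by omega) h
  have hik := Ne.symm hki
  have hjk := Ne.symm hkj
  have hji := Ne.symm hij
  by_cases aki : Γ.Adj k i <;> by_cases akj : Γ.Adj k j <;> by_cases aij : Γ.Adj i j <;>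
    have aki' := aki <;> have akj' := akj <;> have aij' := aij <;>
    rw [Γ.adj_comm] at aki' akj' aij'
  · exact absurd akj (hΓ _ _ _ aki aij)
  · simp only [compl_of_adj aki, compl_of_adj aki', compl_of_adj akj, compl_of_adj akj',
      compl_of_not_adj hij aij, compl_of_not_adj hji aij', mul_assoc, len_mul, len_gen] at *
    exact G.cube_path_middle hij aij aki' akj (by omega) h
  · simp only [compl_of_adj aki, compl_of_adj aki', compl_of_not_adj hkj akj,
      compl_of_not_adj hjk akj', compl_of_adj aij, compl_of_adj aij', mul_assoc, len_mul,
      len_gen] at *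
    exact G.cube_path_end hkj aij aki' akj (by omega) h
  · simp only [compl_of_adj aki, compl_of_adj aki', compl_of_not_adj hkj akj,
      compl_of_not_adj hjk akj', compl_of_not_adj hij aij, compl_of_not_adj hji aij', mul_assoc,
      len_mul, len_gen] at *
    exact G.cube_edge hij hkj aij aki' akj (by omega) h
  · simp only [compl_of_not_adj hki aki, compl_of_not_adj hik aki', compl_of_adj akj,
      compl_of_adj akj', compl_of_adj aij, compl_of_adj aij', mul_assoc, len_mul,
      len_gen] at *
    obtain ⟨z, h1, h2⟩ := G.cube_path_end hki aij' akj' aki (by omega) h.symm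
    exact ⟨z, h2, h1⟩
  · simp only [compl_of_not_adj hki aki, compl_of_not_adj hik aki', compl_of_adj akj,
      compl_of_adj akj', compl_of_not_adj hij aij, compl_of_not_adj hji aij', mul_assoc,
      len_mul, len_gen] at *
    obtain ⟨z, h1, h2⟩ := G.cube_edge hji hki aij' akj' aki (by omega) h.symm
    exact ⟨z, h2, h1⟩
  · simp only [compl_of_not_adj hki aki, compl_of_not_adj hik aki', compl_of_not_adj hkj akj,
      compl_of_not_adj hjk akj', compl_of_adj aij, compl_of_adj aij', mul_assoc, len_mul,
      len_gen] at *
    obtain ⟨z, rfl, rfl⟩ := G.of_adj aij (by omega) h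
    exact ⟨s k * z, by rw [gen_comm_assoc akj, gen_comm_assoc aki],
      by rw [gen_comm_assoc aki, gen_comm_assoc akj]⟩
  · simp only [compl_of_not_adj hki aki, compl_of_not_adj hik aki', compl_of_not_adj hkj akj,
      compl_of_not_adj hjk akj', compl_of_not_adj hij aij, compl_of_not_adj hji aij',
      len_mul, len_gen] at *
    obtain ⟨z, rfl, rfl⟩ := G.of_not_adj hij aij (by omega) h
    exact ⟨s k * z, gen_comm_assoc akj _, gen_comm_assoc aki _⟩

end GarsideBelow

/-- The relation between words that Garside's property asserts for equal words: both are empty, or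
their tails are completed, by the same element, to the shortest common multiple of the heads. -/
inductive HeadRel (Γ : SimpleGraph ι) : List ι → List ι → Prop
  | nil : HeadRel Γ [] []
  | cons (i j : ι) (X Y : List ι) (z : ArtinMonoid Γ) (hX : word Γ X = compl Γ i j * z)
      (hY : word Γ Y = compl Γ j i * z) : HeadRel Γ (i :: X) (j :: Y)

namespace HeadRel

theorem refl (X : List ι) : HeadRel Γ X X := by
  cases X with
  | nil => exact .nil
  | cons i X => exact .cons i i X X (word Γ X) (by simp) (by simp)

theorem symm {X Y : List ι} (h : HeadRel Γ X Y) : HeadRel Γ Y X := by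
  cases h with
  | nil => exact .nil
  | cons i j X Y z hX hY => exact .cons j i Y X z hY hX

theorem trans {n : ℕ} (G : GarsideBelow Γ n) (hΓ : ∀ i j k, Γ.Adj i j → Γ.Adj j k → ¬ Γ.Adj i k)
    {X W Y : List ι} (hn : W.length ≤ n + 1) (h1 : HeadRel Γ X W) (h2 : HeadRel Γ W Y) :
    HeadRel Γ X Y := by
  cases h1 with
  | nil => exact h2
  | cons i k X W u hX hW =>
    cases h2 with
    | cons _ j _ Y v hW' hY =>
      obtain ⟨z, h1, h2⟩ := G.cube hΓ (hW.symm.trans hW')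
        (by rw [← hW, len_word]; simpa using hn)
      exact .cons i j X Y z (hX.trans h1) (hY.trans h2)

theorem append {X Y X' Y' : List ι} (h : HeadRel Γ X Y) (h' : HeadRel Γ X' Y')
    (he : word Γ X' = word Γ Y') : HeadRel Γ (X ++ X') (Y ++ Y') := by
  cases h with
  | nil => exact h'
  | cons i j X Y z hX hY =>
    exact .cons i j _ _ (z * word Γ X') ((word_append X X').trans (by rw [hX, mul_assoc]))
      ((word_append Y Y').trans (by rw [hY, he, mul_assoc]))

end HeadRel

/-- Equal words of bounded length satisfy `HeadRel`, by induction on a derivation of their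
equality from the defining relations. -/
theorem headRel_of_conGen {n : ℕ} (G : GarsideBelow Γ n)
    (hΓ : ∀ i j k, Γ.Adj i j → Γ.Adj j k → ¬ Γ.Adj i k) {X Y : FreeMonoid ι}
    (h : ConGen.Rel (ArtinRel Γ) X Y) (hn : X.toList.length ≤ n + 1) :
    HeadRel Γ X.toList Y.toList := by
  have key : ∀ {X Y : FreeMonoid ι}, ConGen.Rel (ArtinRel Γ) X Y →
      word Γ X.toList = word Γ Y.toList := fun h ↦ PresentedMonoid.mk_eq_mk_iff.2 h
  have keylen : ∀ {X Y : FreeMonoid ι}, ConGen.Rel (ArtinRel Γ) X Y →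
      X.toList.length = Y.toList.length := fun h ↦ by
    rw [← len_word (Γ := Γ), key h, len_word]
  induction h with
  | of X Y h =>
    cases h with
    | braid i j h =>
      exact .cons i j [j, i] [i, j] 1 (by simp [compl_of_adj h]) (by simp [compl_of_adj h.symm])
    | comm i j h =>
      by_cases hij : i = j
      · subst hij; exact .refl _
      · exact .cons i j [j] [i] 1 (by simp [compl_of_not_adj hij h])
          (by simp [compl_of_not_adj (Ne.symm hij) (fun h' ↦ h h'.symm)])
  | refl X => exact .refl _
  | symm h ih => exact (ih (by rw [keylen h]; exact hn)).symm
  | trans h1 h2 ih1 ih2 =>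
    exact (ih1 hn).trans G hΓ (by rw [← keylen h1]; exact hn) (ih2 (by rw [← keylen h1]; exact hn))
  | mul h1 h2 ih1 ih2 =>
    simp only [FreeMonoid.toList_mul, List.length_append] at hn ⊢
    exact (ih1 (by omega)).append (ih2 (by omega)) (key h2)

theorem garsideBelow (hΓ : ∀ i j k, Γ.Adj i j → Γ.Adj j k → ¬ Γ.Adj i k) (n : ℕ) :
    GarsideBelow Γ n := by
  induction n with
  | zero => intro i j a b h; omega
  | succ n ih =>
    intro i j a b ha h
    obtain ⟨X, rfl⟩ := exists_word a
    obtain ⟨Y, rfl⟩ := exists_word b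
    have h' : conGen (ArtinRel Γ) (FreeMonoid.ofList (i :: X)) (FreeMonoid.ofList (j :: Y)) :=
      PresentedMonoid.mk_eq_mk_iff.1 h
    have := headRel_of_conGen ih hΓ h' (by simpa using ha)
    cases this with
    | cons _ _ _ _ z hX hY => exact ⟨z, hX, hY⟩

/-- Garside's property of the Artin monoid. -/
theorem garside (hΓ : ∀ i j k, Γ.Adj i j → Γ.Adj j k → ¬ Γ.Adj i k) {i j : ι}
    {a b : ArtinMonoid Γ} (h : s i * a = s j * b) :
    ∃ c, a = compl Γ i j * c ∧ b = compl Γ j i * c :=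
  garsideBelow hΓ (len a + 1) i j a b (Nat.lt_succ_self _) h

theorem mul_left_cancel_of_triangleFree (hΓ : ∀ i j k, Γ.Adj i j → Γ.Adj j k → ¬ Γ.Adj i k)
    (a : ArtinMonoid Γ) {b c : ArtinMonoid Γ} (h : a * b = a * c) : b = c := by
  obtain ⟨X, rfl⟩ := exists_word a
  induction X with
  | nil => simpa using h
  | cons i X ih =>
    simp only [word_cons, mul_assoc] at h
    exact ih ((garsideBelow hΓ _).cancel (Nat.lt_succ_self _) h)

/-- Two elements with a common right multiple have a least one. -/
theorem exists_lcm (hΓ : ∀ i j k, Γ.Adj i j → Γ.Adj j k → ¬ Γ.Adj i k)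
    {a b m : ArtinMonoid Γ} (ha : a ∣ m) (hb : b ∣ m) : ∃ c, ∀ x, c ∣ x ↔ a ∣ x ∧ b ∣ x := by
  have cancel : ∀ {a b c : ArtinMonoid Γ}, a * b ∣ a * c → b ∣ c := fun {a b c} ⟨d, hd⟩ ↦
    ⟨d, mul_left_cancel_of_triangleFree hΓ a (by rw [hd, mul_assoc])⟩
  induction hn : len m using Nat.strong_induction_on generalizing a b m with
  | _ n ih =>
    rcases eq_one_or_exists_gen_mul a with rfl | ⟨i, a, rfl⟩
    · exact ⟨b, fun x ↦ by simp⟩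
    rcases eq_one_or_exists_gen_mul b with rfl | ⟨j, b, rfl⟩
    · exact ⟨s i * a, fun x ↦ by simp⟩
    obtain ⟨a', rfl⟩ := ha
    obtain ⟨b', hm⟩ := hb
    simp only [mul_assoc] at hm hn
    obtain ⟨q, h1, h2⟩ := garside hΓ hm
    have hlen := congrArg len hm
    simp only [len_mul, len_gen] at hlen hn
    -- `c` and `d` are obtained by closing the two squares next to that of `s i` and `s j`.
    obtain ⟨c, hc⟩ := ih (len (a * a')) (by simp; omega) (Dvd.intro a' rfl)
      (Dvd.intro q h1.symm) rfl
    obtain ⟨d, hd⟩ := ih (len (b * b')) (by simp; omega) (Dvd.intro b' rfl)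
      (Dvd.intro q h2.symm) rfl
    obtain ⟨c', rfl⟩ := ((hc c).1 dvd_rfl).2
    obtain ⟨d', rfl⟩ := ((hd d).1 dvd_rfl).2
    have hcq : c' ∣ q := cancel (h1 ▸ (hc (a * a')).2 ⟨Dvd.intro a' rfl, Dvd.intro q h1.symm⟩)
    have hdq : d' ∣ q := cancel (h2 ▸ (hd (b * b')).2 ⟨Dvd.intro b' rfl, Dvd.intro q h2.symm⟩)
    have hq := congrArg len h1
    simp only [len_mul] at hq
    obtain ⟨e, he⟩ := ih (len q) (by omega) hcq hdq rfl
    refine ⟨s i * (compl Γ i j * e), fun x ↦ ⟨fun hx ↦ ⟨?_, ?_⟩, ?_⟩⟩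
    · refine .trans (mul_dvd_mul_left _ ?_) hx
      exact ((hc _).1 (mul_dvd_mul_left _ ((he e).1 dvd_rfl).1)).1
    · rw [← mul_assoc, gen_mul_compl, mul_assoc] at hx
      refine .trans (mul_dvd_mul_left _ ?_) hx
      exact ((hd _).1 (mul_dvd_mul_left _ ((he e).1 dvd_rfl).2)).1
    · rintro ⟨⟨u, rfl⟩, v, hv⟩
      simp only [mul_assoc] at hv ⊢
      obtain ⟨w, hu, hw⟩ := garside hΓ hv
      rw [hu]
      refine mul_dvd_mul_left _ (mul_dvd_mul_left _ ((he w).2 ⟨?_, ?_⟩))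
      · exact cancel (hu ▸ (hc (a * u)).2 ⟨Dvd.intro u rfl, Dvd.intro w hu.symm⟩)
      · exact cancel (hw ▸ (hd (b * v)).2 ⟨Dvd.intro v rfl, Dvd.intro w hw.symm⟩)

theorem dvd_antisymm {a b : ArtinMonoid Γ} (hab : a ∣ b) (hba : b ∣ a) :
    a = b := by
  obtain ⟨c, rfl⟩ := hab
  obtain ⟨d, hd⟩ := hba
  have := congrArg len hd
  simp only [len_mul] at this
  rw [eq_one_of_len_eq_zero (a := c) (by omega), mul_one]

end ArtinMonoid

/-! ### Groups of fractions with least common multiples are torsion-free -/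

theorem exists_finset_lcm {M : Type*} [Monoid M]
    (hlcm : ∀ a b : M, ∃ c, ∀ x, c ∣ x ↔ a ∣ x ∧ b ∣ x) (A : Finset M) :
    ∃ m, ∀ x, m ∣ x ↔ ∀ a ∈ A, a ∣ x := by
  classical
  induction A using Finset.induction_on with
  | empty => exact ⟨1, by simp⟩
  | insert a A _ ih =>
    obtain ⟨m, hm⟩ := ih
    obtain ⟨c, hc⟩ := hlcm a m
    exact ⟨c, fun x ↦ by simp [hc, hm]⟩

/-- If `z` is central and every element of `M` divides a power of `z`, then every element of a group
generated by `M` becomes positive after multiplication by a power of `z`. -/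
theorem exists_pow_mul_eq {M G : Type*} [Monoid M] [Group G] (z : M) (hz : ∀ a, z * a = a * z)
    (hdvd : ∀ a : M, ∃ k : ℕ, a ∣ z ^ k) (θ : M →* G)
    (hgen : Subgroup.closure (Set.range θ) = ⊤) (g : G) :
    (∀ k : ℕ, θ z ^ k * g = g * θ z ^ k) ∧ ∃ (k : ℕ) (a : M), θ z ^ k * g = θ a := by
  have hg : g ∈ Subgroup.closure (Set.range θ) := hgen ▸ Subgroup.mem_top g
  induction hg using Subgroup.closure_induction with
  | mem g hg =>
    obtain ⟨a, rfl⟩ := hg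
    refine ⟨fun k ↦ ?_, 0, a, by simp⟩
    have : Commute (θ z) (θ a) := Commute.map (hz a) θ
    exact this.pow_left k
  | one => exact ⟨by simp, 0, 1, by simp⟩
  | mul g h _ _ ihg ihh =>
    obtain ⟨hg, k, a, ha⟩ := ihg
    obtain ⟨hh, l, b, hb⟩ := ihh
    refine ⟨fun k ↦ ?_, k + l, a * b, ?_⟩
    · rw [← mul_assoc, hg, mul_assoc, hh, mul_assoc]
    · rw [map_mul, ← ha, ← hb, pow_add, mul_assoc, ← mul_assoc (θ z ^ l), hg l]
      simp only [mul_assoc]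
  | inv g _ ih =>
    obtain ⟨hg, k, a, ha⟩ := ih
    have hg' : ∀ k : ℕ, θ z ^ k * g⁻¹ = g⁻¹ * θ z ^ k := fun k ↦
      (Commute.inv_right (show Commute (θ z ^ k) g from hg k)).eq
    obtain ⟨l, b, hb⟩ := hdvd a
    refine ⟨hg', l, b * z ^ k, ?_⟩
    have h1 : θ z ^ l = θ a * θ b := by rw [← map_pow, hb, map_mul]
    have h2 : θ a * θ b = θ b * θ a := by
      have h3 : Commute (θ z ^ l) (θ a) := by
        rw [← map_pow]
        exact Commute.map (Commute.pow_left (hz a) l) θ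
      have h4 := h3.eq
      rw [h1, mul_assoc] at h4
      exact (mul_left_cancel h4).symm
    rw [h1, h2, ← ha, map_mul, map_pow, hg, mul_assoc, mul_assoc]
    congr 1
    rw [hg', mul_inv_cancel_left]

/-- Let `M` be a submonoid generating a group `G`, such that left divisibility in `M` is
antisymmetric with least common multiples, and such that every element of `M` divides a power of a
central element `z`. Left translation by `g` permutes the powers of `g`. If there are finitely many
of them, it fixes their least common multiple (which exists after a shift by a power of `z`), so
that `g = 1`. -/
theorem torsionFreeGroup_of_lcm {M G : Type*} [Monoid M] [Group G]
    (hcancel : ∀ a b c : M, a * b = a * c → b = c) (hanti : ∀ a b : M, a ∣ b → b ∣ a → a = b)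
    (hlcm : ∀ a b : M, ∃ c, ∀ x, c ∣ x ↔ a ∣ x ∧ b ∣ x) (z : M) (hz : ∀ a, z * a = a * z)
    (hdvd : ∀ a : M, ∃ k : ℕ, a ∣ z ^ k) (θ : M →* G) (hθ : Function.Injective θ)
    (hgen : Subgroup.closure (Set.range θ) = ⊤) : TorsionFreeGroup G := by
  intro g hg
  have hfin : (Subgroup.zpowers g : Set G).Finite := finite_zpowers.2 hg
  have hpos := fun g ↦ (exists_pow_mul_eq z hz hdvd θ hgen g).2
  have hcen := fun g ↦ (exists_pow_mul_eq z hz hdvd θ hgen g).1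
  choose K P hKP using hpos
  obtain ⟨k, hk⟩ : ∃ k : ℕ, ∀ x ∈ Subgroup.zpowers g, ∃ a, θ z ^ k * x = θ a := by
    refine ⟨hfin.toFinset.sup K, fun x hx ↦ ?_⟩
    have hle : K x ≤ hfin.toFinset.sup K := Finset.le_sup (f := K) (hfin.mem_toFinset.2 hx)
    refine ⟨z ^ (hfin.toFinset.sup K - K x) * P x, ?_⟩
    rw [map_mul, map_pow, ← hKP, ← mul_assoc, ← pow_add, Nat.sub_add_cancel hle]
  have hA : (θ ⁻¹' ((fun x ↦ θ z ^ k * x) '' (Subgroup.zpowers g : Set G))).Finite :=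
    (hfin.image _).preimage hθ.injOn
  obtain ⟨m, hm⟩ := exists_finset_lcm hlcm hA.toFinset
  have hmem : ∀ a, a ∈ hA.toFinset ↔ ∃ x ∈ Subgroup.zpowers g, θ z ^ k * x = θ a := by
    intro a
    simp only [Set.Finite.mem_toFinset, Set.mem_preimage, Set.mem_image, SetLike.mem_coe]
  have hlcm_mul : ∀ h x, (∀ a ∈ hA.toFinset, h * a ∣ x) → h * m ∣ x := by
    intro h x hx
    obtain ⟨a, ha⟩ := hk 1 (one_mem _)
    obtain ⟨y, rfl⟩ := dvd_of_mul_right_dvd (hx a ((hmem a).2 ⟨1, one_mem _, ha⟩))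
    refine mul_dvd_mul_left h ((hm y).2 fun b hb ↦ ?_)
    obtain ⟨c, hc⟩ := hx b hb
    exact ⟨c, hcancel h _ _ (by rw [hc, mul_assoc])⟩
  have hdm : ∀ a ∈ hA.toFinset, a ∣ m := (hm m).1 dvd_rfl
  obtain ⟨l, h, hl⟩ : ∃ l h, θ z ^ l * g = θ h := ⟨K g, P g, hKP g⟩
  have hgz := Subgroup.mem_zpowers g
  have hfix : h * m = z ^ l * m := by
    apply hanti
    · refine hlcm_mul _ _ fun a ha ↦ ?_
      obtain ⟨x, hx, hxa⟩ := (hmem a).1 ha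
      obtain ⟨b, hb⟩ := hk (g * x) (mul_mem hgz hx)
      have : h * a = z ^ l * b := hθ (by
        rw [map_mul, map_mul, ← hl, ← hxa, ← hb, map_pow, mul_assoc, ← mul_assoc g, ← hcen g,
          mul_assoc])
      rw [this]
      exact mul_dvd_mul_left _ (hdm b ((hmem b).2 ⟨_, mul_mem hgz hx, hb⟩))
    · refine hlcm_mul _ _ fun a ha ↦ ?_
      obtain ⟨x, hx, hxa⟩ := (hmem a).1 ha
      obtain ⟨b, hb⟩ := hk (g⁻¹ * x) (mul_mem (inv_mem hgz) hx)
      have : z ^ l * a = h * b := hθ (by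
        rw [map_mul, map_mul, ← hl, ← hxa, ← hb, map_pow, mul_assoc, ← mul_assoc g, ← hcen g,
          mul_assoc, mul_inv_cancel_left])
      rw [this]
      exact mul_dvd_mul_left _ (hdm b ((hmem b).2 ⟨_, mul_mem (inv_mem hgz) hx, hb⟩))
  have hθh := congrArg θ hfix
  rw [map_mul, map_mul, mul_left_inj, ← hl, map_pow] at hθh
  simpa using hθh

open OreLocalization in
/-- A left cancellative monoid in which every element divides a power of a central element `z`
embeds in the group of units of its localization at the powers of `z`. -/
theorem exists_units_hom_injective.{u} {M : Type u} [Monoid M]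
    (hcancel : ∀ a b c : M, a * b = a * c → b = c) (z : M) (hz : ∀ a, z * a = a * z)
    (hdvd : ∀ a : M, ∃ k : ℕ, a ∣ z ^ k) :
    ∃ (L : Type u) (_ : Monoid L) (f : M →* Lˣ), Function.Injective f := by
  have hpow : ∀ (s : Submonoid.powers z) (a : M), (s : M) * a = a * s := by
    rintro ⟨_, k, rfl⟩ a
    exact (Commute.pow_left (hz a) k).eq
  let _ : OreSet (Submonoid.powers z) :=
    { ore_right_cancel := fun a b s h ↦ ⟨s, by rw [hpow, hpow, h]⟩
      oreNum := fun a _ ↦ a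
      oreDenom := fun _ s ↦ s
      ore_eq := fun a s ↦ hpow s a }
  let f : M →* OreLocalization (Submonoid.powers z) M := numeratorHom
  have hinj : Function.Injective f := by
    intro a b h
    obtain ⟨u, v, h1, h2⟩ := oreDiv_eq_iff.1 h
    simp only [Submonoid.coe_one, mul_one] at h2
    rw [← h2] at h1
    exact (hcancel _ _ _ h1).symm
  have hunit : ∀ a, IsUnit (f a) := by
    intro a
    obtain ⟨k, b, hb⟩ := hdvd a
    have hba : b * a = z ^ k := hcancel a _ _ (by
      rw [← mul_assoc, ← hb]; exact (Commute.pow_left (hz a) k).eq)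
    have hu : IsUnit (f (z ^ k)) := numerator_isUnit (⟨z ^ k, k, rfl⟩ : Submonoid.powers z)
    obtain ⟨w, hw⟩ := hu
    have h1 : f a * f b = w := by rw [← map_mul, ← hb, hw]
    have h2 : f b * f a = w := by rw [← map_mul, hba, hw]
    refine isUnit_iff_exists_and_exists.2 ⟨⟨f b * ↑w⁻¹, ?_⟩, ↑w⁻¹ * f b, ?_⟩
    · rw [← mul_assoc, h1, Units.mul_inv]
    · rw [mul_assoc, h2, Units.inv_mul]
  refine ⟨OreLocalization (Submonoid.powers z) M, inferInstance,
    IsUnit.liftRight f hunit, fun a b h ↦ hinj ?_⟩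
  rw [← IsUnit.coe_liftRight f hunit a, h, IsUnit.coe_liftRight]

/-! ### Central elements of braid monoids -/

section Coxeter

variable {M : Type*} [Monoid M] (g : ℕ → M) (N : ℕ)

/-- The product `g 0 * g 1 * ⋯ * g (k - 1)`. -/
def stairProd : ℕ → M
  | 0 => 1
  | k + 1 => stairProd k * g k

theorem dvd_stairProd {k : ℕ} (hk : 0 < k) : g 0 ∣ stairProd g k := by
  induction k with
  | zero => omega
  | succ k ih =>
    rcases Nat.eq_zero_or_pos k with rfl | h
    · exact ⟨1, by simp [stairProd]⟩
    · exact Dvd.dvd.mul_right (ih h) _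

variable {g N} (hb : ∀ i, i + 1 < N → g i * g (i + 1) * g i = g (i + 1) * g i * g (i + 1))
  (hc : ∀ i j, i + 1 < j → j < N → Commute (g i) (g j))

include hc

theorem commute_stairProd {k j : ℕ} (hkj : k < j) (hj : j < N) :
    Commute (stairProd g k) (g j) := by
  induction k with
  | zero => exact Commute.one_left _
  | succ k ih => exact (ih (by omega)).mul_left (hc k j hkj hj)

include hb

/-- Conjugation by the Coxeter element moves each generator but the last to the next one. -/
theorem stairProd_mul {i k : ℕ} (hik : i + 1 < k) (hk : k ≤ N) :
    stairProd g k * g i = g (i + 1) * stairProd g k := by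
  induction k, (show i + 2 ≤ k from hik) using Nat.le_induction with
  | base =>
    have h := (commute_stairProd hc (show i < i + 1 by omega) (by omega)).eq
    calc stairProd g i * g i * g (i + 1) * g i
        = stairProd g i * (g i * g (i + 1) * g i) := by simp only [mul_assoc]
      _ = stairProd g i * g (i + 1) * (g i * g (i + 1)) := by
        rw [hb i (by omega)]; simp only [mul_assoc]
      _ = g (i + 1) * (stairProd g i * g i * g (i + 1)) := by rw [h]; simp only [mul_assoc]
  | succ k hk' ih =>
    change stairProd g k * g k * g i = g (i + 1) * (stairProd g k * g k)
    rw [mul_assoc, ← (hc i k (by omega) (by omega)).eq, ← mul_assoc, ih (by omega) (by omega),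
      mul_assoc]

theorem stairProd_pow_mul {i m : ℕ} (him : i + m < N) :
    stairProd g N ^ m * g i = g (i + m) * stairProd g N ^ m := by
  induction m with
  | zero => simp
  | succ m ih =>
    rw [pow_succ', mul_assoc, ih (by omega), ← mul_assoc,
      stairProd_mul hb hc (show i + m + 1 < N by omega) le_rfl, mul_assoc]
    rfl

theorem stairProd_sq_mul (hN : 0 < N) :
    stairProd g N ^ 2 * g (N - 1) = g 0 * stairProd g N ^ 2 := by
  have key : ∀ k < N, g 0 * (stairProd g N * stairProd g k) =
      stairProd g (k + 1) * stairProd g N := by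
    intro k hk
    induction k with
    | zero => simp [stairProd]
    | succ k ih =>
      calc g 0 * (stairProd g N * (stairProd g k * g k))
          = g 0 * (stairProd g N * stairProd g k) * g k := by simp only [mul_assoc]
        _ = stairProd g (k + 1) * (stairProd g N * g k) := by
          rw [ih (by omega), mul_assoc]
        _ = stairProd g (k + 2) * stairProd g N := by
          rw [stairProd_mul hb hc hk le_rfl, ← mul_assoc]; rfl
  have h := key (N - 1) (by omega)
  have hN' : stairProd g N = stairProd g (N - 1) * g (N - 1) := by
    obtain ⟨n, rfl⟩ := Nat.exists_eq_succ_of_ne_zero hN.ne'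
    rfl
  rw [Nat.sub_add_cancel hN] at h
  calc stairProd g N ^ 2 * g (N - 1)
      = g 0 * (stairProd g N * (stairProd g (N - 1) * g (N - 1))) := by
        rw [pow_two, ← h]; simp only [mul_assoc]
    _ = g 0 * stairProd g N ^ 2 := by rw [← hN', pow_two]

/-- The `(N + 1)`-st power of the Coxeter element (the full twist on `N + 1` strands) is central:
conjugation by the Coxeter element moves `g i` to `g (i + 1)`, and its square moves the last
generator to the first. -/
theorem commute_stairProd_pow {i : ℕ} (hi : i < N) : Commute (stairProd g N ^ (N + 1)) (g i) := by
  have h1 := stairProd_pow_mul hb hc (show i + (N - 1 - i) < N by omega)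
  have h2 := stairProd_sq_mul hb hc (by omega)
  have h3 := stairProd_pow_mul hb hc (show 0 + i < N by omega)
  rw [show i + (N - 1 - i) = N - 1 by omega] at h1
  rw [zero_add] at h3
  change _ * _ = _ * _
  rw [show N + 1 = i + 2 + (N - 1 - i) by omega, pow_add, pow_add, mul_assoc, h1, mul_assoc,
    ← mul_assoc (stairProd g N ^ 2), h2, ← mul_assoc, ← mul_assoc, h3]
  simp only [mul_assoc]

theorem dvd_stairProd_pow {i : ℕ} (hi : i < N) : g i ∣ stairProd g N ^ (N + 1) := by
  have h3 := stairProd_pow_mul hb hc (show 0 + i < N by omega)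
  obtain ⟨r, hr⟩ := dvd_stairProd g (show 0 < N by omega)
  refine Dvd.dvd.trans ⟨stairProd g N ^ i * r, ?_⟩ (pow_dvd_pow _ (show i + 1 ≤ N + 1 by omega))
  rw [zero_add] at h3
  rw [← mul_assoc, ← h3, mul_assoc, ← hr, pow_succ]

end Coxeter

/-! ### Braid groups -/

namespace BraidGroup

variable {n : ℕ}

theorem sigma_braid (i j : BraidIndex n) (h : (j : ℕ) = i + 1) :
    (sigma i * sigma j * sigma i : BraidGroup n) = sigma j * sigma i * sigma j :=
  PresentedGroup.mk_eq_mk_of_mul_inv_mem ⟨_, _, BraidRel.braid i j h, rfl⟩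

theorem sigma_comm (i j : BraidIndex n) (h : (j : ℕ) > i + 1) :
    (sigma i * sigma j : BraidGroup n) = sigma j * sigma i :=
  PresentedGroup.mk_eq_mk_of_mul_inv_mem ⟨_, _, BraidRel.comm i j h, rfl⟩

/-- The homomorphism determined by the images of the generators. -/
def lift {H : Type*} [Group H] (f : BraidIndex n → H)
    (hb : ∀ i j : BraidIndex n, (j : ℕ) = i + 1 → f i * f j * f i = f j * f i * f j)
    (hc : ∀ i j : BraidIndex n, (j : ℕ) > i + 1 → f i * f j = f j * f i) : BraidGroup n →* H :=
  PresentedGroup.toGroup (f := f) (by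
    rintro _ ⟨_, _, ⟨i, j, h⟩ | ⟨i, j, h⟩, rfl⟩
    · rw [map_mul, map_inv, mul_inv_eq_one]; simpa using hb i j h
    · rw [map_mul, map_inv, mul_inv_eq_one]; simpa using hc i j h)

@[simp]
theorem lift_sigma {H : Type*} [Group H] (f : BraidIndex n → H)
    (hb : ∀ i j : BraidIndex n, (j : ℕ) = i + 1 → f i * f j * f i = f j * f i * f j)
    (hc : ∀ i j : BraidIndex n, (j : ℕ) > i + 1 → f i * f j = f j * f i) (i : BraidIndex n) :
    lift f hb hc (sigma i) = f i :=
  PresentedGroup.toGroup.of _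

/-- The path on the vertices `1, …, n - 1`. -/
def pathGraph (n : ℕ) : SimpleGraph (BraidIndex n) where
  Adj i j := (i : ℕ) + 1 = j ∨ (j : ℕ) + 1 = i
  symm := ⟨fun _ _ h ↦ h.symm⟩
  loopless := ⟨fun i h ↦ by omega⟩

theorem pathGraph_triangleFree (i j k : BraidIndex n) (h : (pathGraph n).Adj i j)
    (h' : (pathGraph n).Adj j k) : ¬ (pathGraph n).Adj i k := by
  simp only [pathGraph] at *
  omega

theorem sigma_comm_of_not_adj (i j : BraidIndex n) (h : ¬ (pathGraph n).Adj i j) :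
    (sigma i * sigma j : BraidGroup n) = sigma j * sigma i := by
  simp only [pathGraph, not_or] at h
  rcases lt_trichotomy (i : ℕ) j with hij | hij | hij
  · exact sigma_comm i j (by omega)
  · rw [Subtype.ext hij]
  · exact (sigma_comm j i (by omega)).symm

/-- The homomorphism from the monoid of positive braids to the braid group. -/
def ofMonoid (n : ℕ) : ArtinMonoid (pathGraph n) →* BraidGroup n :=
  PresentedMonoid.lift sigma (by
    rintro _ _ (⟨i, j, h⟩ | ⟨i, j, h⟩)
    · rcases h with h | h
      · simpa using sigma_braid i j h.symm
      · simpa using (sigma_braid j i h.symm).symm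
    · simpa using sigma_comm_of_not_adj i j h)

@[simp]
theorem ofMonoid_gen (i : BraidIndex n) : ofMonoid n (ArtinMonoid.gen _ i) = sigma i := rfl

theorem closure_range_ofMonoid : Subgroup.closure (Set.range (ofMonoid n)) = ⊤ := by
  rw [eq_top_iff, ← PresentedGroup.closure_range_of]
  refine Subgroup.closure_mono ?_
  rintro _ ⟨i, rfl⟩
  exact ⟨ArtinMonoid.gen _ i, rfl⟩

/-- The positive full twist: a central element that is divided by every generator. -/
theorem exists_central_dvd (n : ℕ) : ∃ z : ArtinMonoid (pathGraph n),
    (∀ i, z * ArtinMonoid.gen _ i = ArtinMonoid.gen _ i * z) ∧ ∀ i, ArtinMonoid.gen _ i ∣ z := by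
  let g : ℕ → ArtinMonoid (pathGraph n) := fun k ↦
    if h : k + 1 < n then ArtinMonoid.gen _ ⟨k + 1, by omega, h⟩ else 1
  have hg : ∀ i : BraidIndex n, g (i - 1) = ArtinMonoid.gen _ i := by
    rintro ⟨i, h1, h2⟩
    have : i - 1 + 1 = i := by omega
    simp only [g, this]
    rw [dif_pos h2]
  have hb : ∀ i, i + 1 < n - 1 → g i * g (i + 1) * g i = g (i + 1) * g i * g (i + 1) := by
    intro i hi
    simp only [g]
    rw [dif_pos (by omega), dif_pos (by omega)]
    exact ArtinMonoid.gen_braid (.inl rfl)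
  have hc : ∀ i j, i + 1 < j → j < n - 1 → Commute (g i) (g j) := by
    intro i j hij hj
    simp only [g]
    rw [dif_pos (by omega), dif_pos (by omega)]
    refine ArtinMonoid.gen_comm ?_
    simp only [pathGraph]
    omega
  refine ⟨stairProd g (n - 1) ^ (n - 1 + 1), fun i ↦ ?_, fun i ↦ ?_⟩
  all_goals
    have hi : (i : ℕ) - 1 < n - 1 := by have := i.2.1; have := i.2.2; omega
    rw [← hg i]
  · exact (commute_stairProd_pow hb hc hi).eq
  · exact dvd_stairProd_pow hb hc hi

theorem torsionFreeGroup (n : ℕ) : TorsionFreeGroup (BraidGroup n) := by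
  have hΓ := pathGraph_triangleFree (n := n)
  have hcancel : ∀ a b c : ArtinMonoid (pathGraph n), a * b = a * c → b = c := fun a _ _ ↦
    ArtinMonoid.mul_left_cancel_of_triangleFree hΓ a
  obtain ⟨z, hz, hdvd⟩ := exists_central_dvd n
  have hz' : ∀ a, z * a = a * z := by
    intro a
    obtain ⟨X, rfl⟩ := ArtinMonoid.exists_word a
    induction X with
    | nil => simp
    | cons i X ih => rw [ArtinMonoid.word_cons, ← mul_assoc, hz, mul_assoc, ih, mul_assoc]
  have hdvd' : ∀ a, ∃ k : ℕ, a ∣ z ^ k := by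
    intro a
    obtain ⟨X, rfl⟩ := ArtinMonoid.exists_word a
    induction X with
    | nil => exact ⟨0, by simp⟩
    | cons i X ih =>
      obtain ⟨k, b, hb⟩ := ih
      obtain ⟨c, hc⟩ := hdvd i
      refine ⟨k + 1, b * c, ?_⟩
      rw [ArtinMonoid.word_cons, mul_assoc, ← mul_assoc (ArtinMonoid.word _ X), ← hb, ← mul_assoc,
        ← (Commute.pow_left (hz' _) k).eq, mul_assoc, ← hc, pow_succ]
  have hlcm : ∀ a b : ArtinMonoid (pathGraph n), ∃ c, ∀ x, c ∣ x ↔ a ∣ x ∧ b ∣ x := by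
    intro a b
    obtain ⟨k, hk⟩ := hdvd' a
    obtain ⟨l, hl⟩ := hdvd' b
    exact ArtinMonoid.exists_lcm hΓ (hk.trans (pow_dvd_pow z (Nat.le_add_right k l)))
      (hl.trans (pow_dvd_pow z (Nat.le_add_left l k)))
  -- An embedding of the monoid in any group factors through the braid group.
  have hinj : Function.Injective (ofMonoid n) := by
    obtain ⟨L, _, f, hf⟩ := exists_units_hom_injective hcancel z hz' hdvd'
    let F : BraidGroup n →* Lˣ := lift (fun i ↦ f (ArtinMonoid.gen _ i))
      (fun i j h ↦ by
        have hij : (pathGraph n).Adj i j := .inl h.symm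
        simp only [← map_mul]
        rw [ArtinMonoid.gen_braid hij])
      (fun i j h ↦ by
        simp only [← map_mul]
        rw [ArtinMonoid.gen_comm (by simp only [pathGraph]; omega)])
    have hF : F.comp (ofMonoid n) = f := by
      ext i
      exact congrArg Units.val
        (show F (sigma i) = f (ArtinMonoid.gen _ i) from lift_sigma _ _ _ i)
    rw [← hF] at hf
    exact Function.Injective.of_comp hf
  exact torsionFreeGroup_of_lcm hcancel (fun _ _ ↦ ArtinMonoid.dvd_antisymm) hlcm z
    hz' hdvd' (ofMonoid n) hinj closure_range_ofMonoid

end BraidGroup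

/-! ### Singular braid groups -/

section FourStrands

variable {G : Type*} [Group G] {a b c t : G}

theorem braid_wordA_comm (hab : a * b * a = b * a * b) :
    b * a ^ 2 * b * a = a * (b * a ^ 2 * b) := by
  calc b * a ^ 2 * b * a = b * a * (a * b * a) := by simp only [pow_two, mul_assoc]
    _ = b * a * b * (a * b) := by rw [hab]; simp only [mul_assoc]
    _ = a * (b * a ^ 2 * b) := by rw [← hab]; simp only [pow_two, mul_assoc]

theorem braid_wordB_mul_left (hab : a * b * a = b * a * b) (hbc : b * c * b = c * b * c) :
    b * c * a * b * a = c * (b * c * a * b) := by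
  calc b * c * a * b * a = b * c * (a * b * a) := by simp only [mul_assoc]
    _ = b * c * b * (a * b) := by rw [hab]; simp only [mul_assoc]
    _ = c * (b * c * a * b) := by rw [hbc]; simp only [mul_assoc]

theorem braid_wordB_mul_right (hab : a * b * a = b * a * b) (hbc : b * c * b = c * b * c)
    (hac : a * c = c * a) : b * c * a * b * c = a * (b * c * a * b) := by
  calc b * c * a * b * c = b * (c * a) * (b * c) := by simp only [mul_assoc]
    _ = b * a * (c * b * c) := by rw [← hac]; simp only [mul_assoc]
    _ = b * a * b * (c * b) := by rw [← hbc]; simp only [mul_assoc]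
    _ = a * (b * (a * c) * b) := by rw [← hab]; simp only [mul_assoc]
    _ = a * (b * c * a * b) := by rw [hac]; simp only [mul_assoc]

theorem braid_wordB_sq_mul (hab : a * b * a = b * a * b) (hbc : b * c * b = c * b * c)
    (hac : a * c = c * a) :
    (b * c * a * b) * (b * c * a * b) * c = (b * a ^ 2 * b) * c * (b * a ^ 2 * b) := by
  have hca : c * a ^ 2 = a ^ 2 * c := (Commute.pow_left hac 2).eq.symm
  calc (b * c * a * b) * (b * c * a * b) * c = b * (c * a) * b * (b * c * a * b * c) := by
        simp only [mul_assoc]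
    _ = b * (c * a) * (b * a * b) * (c * a) * b := by
        rw [braid_wordB_mul_right hab hbc hac]; simp only [mul_assoc]
    _ = b * (c * a ^ 2) * b * (a * c) * a * b := by
        rw [← hab]; simp only [pow_two, mul_assoc]
    _ = b * (a ^ 2 * c) * b * (c * a) * a * b := by rw [hca, hac]
    _ = b * a ^ 2 * (c * b * c) * a ^ 2 * b := by simp only [pow_two, mul_assoc]
    _ = (b * a ^ 2 * b) * c * (b * a ^ 2 * b) := by rw [← hbc]; simp only [mul_assoc]

/-- If `t` commutes with `c` and `b * a ^ 2 * b`, then the four-strand relation between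
`t * a` and the word `b * c * a * b` says that `t` commutes with its conjugate by this word. -/
theorem wordB_relation_iff (hab : a * b * a = b * a * b) (hbc : b * c * b = c * b * c)
    (hac : a * c = c * a) (hc : Commute t c) (hA : Commute t (b * a ^ 2 * b)) :
    (b * c * a * b) * (t * a) * (b * c * a * b) * (t * a) =
        (t * a) * (b * c * a * b) * (t * a) * (b * c * a * b) ↔
      Commute t ((b * c * a * b) * t * (b * c * a * b)⁻¹) := by
  have h1 := braid_wordB_mul_left hab hbc
  have h2 := braid_wordB_mul_right hab hbc hac
  have h3 := braid_wordB_sq_mul hab hbc hac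
  set A := b * a ^ 2 * b
  set B := b * c * a * b
  have hB : Commute t (B * B) := by
    rw [eq_mul_inv_of_mul_eq h3]
    exact ((hA.mul_right hc).mul_right hA).mul_right hc.inv_right
  have e1 : B * (t * a) * B * (t * a) = B * t * B * t * (c * a) := by
    calc B * (t * a) * B * (t * a) = B * t * (a * B) * (t * a) := by simp only [mul_assoc]
      _ = B * t * B * (c * t) * a := by rw [← h2]; simp only [mul_assoc]
      _ = B * t * B * t * (c * a) := by rw [← hc.eq]; simp only [mul_assoc]
  have e2 : t * a * B * (t * a) * B = t * B * t * B * (c * a) := by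
    calc t * a * B * (t * a) * B = t * (a * B) * t * (a * B) := by simp only [mul_assoc]
      _ = t * B * (c * t) * B * c := by rw [← h2]; simp only [mul_assoc]
      _ = t * B * t * (c * B) * c := by rw [← hc.eq]; simp only [mul_assoc]
      _ = t * B * t * B * (a * c) := by rw [← h1]; simp only [mul_assoc]
      _ = t * B * t * B * (c * a) := by rw [hac]
  have e3 : B * t * B * t = B * t * B⁻¹ * t * (B * B) := by
    calc B * t * B * t = B * t * B⁻¹ * (B * B * t) := by group
      _ = B * t * B⁻¹ * t * (B * B) := by rw [← hB.eq]; simp only [mul_assoc]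
  have e4 : t * B * t * B = t * (B * t * B⁻¹) * (B * B) := by group
  rw [e1, e2, mul_left_inj, e3, e4, mul_left_inj]
  exact eq_comm

end FourStrands

namespace SingularBraidGroup

variable {n : ℕ}

theorem mk_eq_of_rel {u v : FreeGroup (SingularBraidGen n)} (h : SingularBraidRel n u v) :
    (PresentedGroup.mk _ u : SingularBraidGroup n) = PresentedGroup.mk _ v :=
  PresentedGroup.mk_eq_mk_of_mul_inv_mem ⟨_, _, h, rfl⟩

/-- The homomorphism determined by the images of the generators. -/
def lift {H : Type*} [Group H] (f : SingularBraidGen n → H)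
    (hf : ∀ u v, SingularBraidRel n u v → FreeGroup.lift f u = FreeGroup.lift f v) :
    SingularBraidGroup n →* H :=
  PresentedGroup.toGroup (f := f) (by
    rintro _ ⟨u, v, h, rfl⟩
    rw [map_mul, map_inv, mul_inv_eq_one, hf u v h])

@[simp]
theorem lift_sigma {H : Type*} [Group H] (f : SingularBraidGen n → H)
    (hf : ∀ u v, SingularBraidRel n u v → FreeGroup.lift f u = FreeGroup.lift f v)
    (i : BraidIndex n) : lift f hf (sigma i) = f (.sigma i) :=
  PresentedGroup.toGroup.of _

@[simp]
theorem lift_tauOne {H : Type*} [Group H] (f : SingularBraidGen n → H)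
    (hf : ∀ u v, SingularBraidRel n u v → FreeGroup.lift f u = FreeGroup.lift f v)
    (h : 1 < n) : lift f hf (tauOne h) = f (.tau h) :=
  PresentedGroup.toGroup.of _

theorem hom_ext {H : Type*} [Group H] {f g : SingularBraidGroup n →* H}
    (hs : ∀ i, f (sigma i) = g (sigma i)) (ht : ∀ h, f (tauOne h) = g (tauOne h)) : f = g :=
  PresentedGroup.ext fun
    | .sigma i => hs i
    | .tau h => ht h

/-- The homomorphism `B_n →* SG_n` that sends `σ_i` to `σ_i`. -/
def ofBraid (n : ℕ) : BraidGroup n →* SingularBraidGroup n :=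
  BraidGroup.lift sigma (fun i j h ↦ mk_eq_of_rel (.braid i j h))
    (fun i j h ↦ mk_eq_of_rel (.comm i j h))

@[simp]
theorem ofBraid_sigma (i : BraidIndex n) : ofBraid n (BraidGroup.sigma i) = sigma i :=
  BraidGroup.lift_sigma _ _ _ i

/-- The element `τ_1 σ_1⁻¹`. -/
def twist (h : 1 < n) : SingularBraidGroup n := tauOne h * (sigma ⟨1, le_rfl, h⟩)⁻¹

theorem twist_mul_sigma (h : 1 < n) : twist h * sigma ⟨1, le_rfl, h⟩ = tauOne h := by
  simp [twist]

theorem sigma_mul_sigma_one_comm (h : 1 < n) (i : BraidIndex n) (hi : (i : ℕ) ≠ 2) :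
    (BraidGroup.sigma i * BraidGroup.sigma ⟨1, le_rfl, h⟩ : BraidGroup n) =
      BraidGroup.sigma ⟨1, le_rfl, h⟩ * BraidGroup.sigma i := by
  apply BraidGroup.sigma_comm_of_not_adj
  have := i.2.1
  simp only [BraidGroup.pathGraph]
  omega

theorem commute_twist_sigma (h : 1 < n) (i : BraidIndex n) (hi : (i : ℕ) ≠ 2) :
    Commute (twist h) (sigma i) := by
  have h1 : Commute (tauOne h) (sigma i) := (mk_eq_of_rel (.tau_sigma h i hi)).symm
  have h2 : Commute (sigma ⟨1, le_rfl, h⟩ : SingularBraidGroup n) (sigma i) := by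
    have := congrArg (ofBraid n) (sigma_mul_sigma_one_comm h i hi)
    simp only [map_mul, ofBraid_sigma] at this
    exact this.symm
  exact h1.mul_left h2.inv_left

theorem commute_twist_wordA (h : 2 < n) :
    Commute (twist (n := n) (by omega)) (sigma ⟨2, by omega, h⟩ * sigma ⟨1, le_rfl, by omega⟩ ^ 2 *
      sigma ⟨2, by omega, h⟩) := by
  have h1 : Commute (tauOne (n := n) (by omega)) (sigma ⟨2, by omega, h⟩ *
      sigma ⟨1, le_rfl, by omega⟩ ^ 2 * sigma ⟨2, by omega, h⟩) :=
    (mk_eq_of_rel (.tau_wordA h)).symm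
  refine h1.mul_left (Commute.inv_left ?_)
  exact (braid_wordA_comm (mk_eq_of_rel (.braid ⟨1, le_rfl, by omega⟩ ⟨2, by omega, h⟩ rfl))).symm

theorem commute_twist_conj_wordB (h : 3 < n) :
    Commute (twist (n := n) (by omega))
      ((sigma ⟨2, by omega, by omega⟩ * sigma ⟨3, by omega, h⟩ * sigma ⟨1, le_rfl, by omega⟩ *
        sigma ⟨2, by omega, by omega⟩) * twist (by omega) *
        (sigma ⟨2, by omega, by omega⟩ * sigma ⟨3, by omega, h⟩ * sigma ⟨1, le_rfl, by omega⟩ *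
        sigma ⟨2, by omega, by omega⟩)⁻¹) := by
  rw [← wordB_relation_iff (a := sigma ⟨1, le_rfl, by omega⟩)
    (mk_eq_of_rel (.braid ⟨1, le_rfl, by omega⟩ ⟨2, by omega, by omega⟩ rfl))
    (mk_eq_of_rel (.braid ⟨2, by omega, by omega⟩ ⟨3, by omega, h⟩ rfl))
    (mk_eq_of_rel (.comm ⟨1, le_rfl, by omega⟩ ⟨3, by omega, h⟩ (by simp)))
    (commute_twist_sigma _ _ (by simp)) (commute_twist_wordA (by omega)), twist_mul_sigma]
  exact mk_eq_of_rel (.tau_wordB h)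

/-- Images of the `σ_i` under a homomorphism from the braid group, together with an element `x`
subject to the relations of the twist `τ_1 σ_1⁻¹`, determine a homomorphism from the singular braid
group. -/
def liftTwist {H : Type*} [Group H] (s : BraidGroup n →* H) (x : 1 < n → H)
    (hx : ∀ (h : 1 < n) (i : BraidIndex n), (i : ℕ) ≠ 2 → Commute (x h) (s (BraidGroup.sigma i)))
    (hA : ∀ h : 2 < n, Commute (x (by omega)) (s (BraidGroup.sigma ⟨2, by omega, h⟩ *
      BraidGroup.sigma ⟨1, le_rfl, by omega⟩ ^ 2 * BraidGroup.sigma ⟨2, by omega, h⟩)))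
    (hB : ∀ h : 3 < n, ∀ B, B = s (BraidGroup.sigma ⟨2, by omega, by omega⟩ *
      BraidGroup.sigma ⟨3, by omega, h⟩ * BraidGroup.sigma ⟨1, le_rfl, by omega⟩ *
      BraidGroup.sigma ⟨2, by omega, by omega⟩) →
      Commute (x (by omega)) (B * x (by omega) * B⁻¹)) :
    SingularBraidGroup n →* H :=
  lift (fun
    | .sigma i => s (BraidGroup.sigma i)
    | .tau h => x h * s (BraidGroup.sigma ⟨1, le_rfl, h⟩)) (by
    have hb : ∀ i j : BraidIndex n, (j : ℕ) = i + 1 → s (BraidGroup.sigma i) *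
        s (BraidGroup.sigma j) * s (BraidGroup.sigma i) = s (BraidGroup.sigma j) *
        s (BraidGroup.sigma i) * s (BraidGroup.sigma j) := by
      intro i j h
      simp only [← map_mul, BraidGroup.sigma_braid i j h]
    have hc : ∀ i j : BraidIndex n, (j : ℕ) > i + 1 → s (BraidGroup.sigma i) *
        s (BraidGroup.sigma j) = s (BraidGroup.sigma j) * s (BraidGroup.sigma i) := by
      intro i j h
      simp only [← map_mul, BraidGroup.sigma_comm i j h]
    simp only [map_mul, map_pow] at hA hB
    rintro _ _ (⟨i, j, h⟩ | ⟨i, j, h⟩ | h | ⟨h, i, hi⟩ | h)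
    · simpa using hb i j h
    · simpa using hc i j h
    · simp only [map_mul, map_pow, FreeGroup.lift_apply_of]
      have h1 := (braid_wordA_comm (hb ⟨1, le_rfl, by omega⟩ ⟨2, by omega, h⟩ rfl)).symm
      exact ((hA h).mul_left h1).eq.symm
    · simp only [map_mul, FreeGroup.lift_apply_of]
      have h1 : Commute (s (BraidGroup.sigma ⟨1, le_rfl, h⟩)) (s (BraidGroup.sigma i)) := by
        have := congrArg s (sigma_mul_sigma_one_comm h i hi)
        simp only [map_mul] at this
        exact this.symm
      exact ((hx h i hi).mul_left h1).eq.symm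
    · simp only [map_mul, FreeGroup.lift_apply_of]
      refine (wordB_relation_iff
        (hb ⟨1, le_rfl, by omega⟩ ⟨2, by omega, by omega⟩ rfl)
        (hb ⟨2, by omega, by omega⟩ ⟨3, by omega, h⟩ rfl)
        (hc ⟨1, le_rfl, by omega⟩ ⟨3, by omega, h⟩ (by simp))
        (hx _ _ (by simp)) (hA (by omega))).2 (hB h _ rfl))

section

variable {H : Type*} [Group H] (s : BraidGroup n →* H) (x : 1 < n → H) (hx hA hB)

@[simp]
theorem liftTwist_sigma (i : BraidIndex n) :
    liftTwist s x hx hA hB (sigma i) = s (BraidGroup.sigma i) :=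
  lift_sigma _ _ _

@[simp]
theorem liftTwist_tauOne (h : 1 < n) :
    liftTwist s x hx hA hB (tauOne h) = x h * s (BraidGroup.sigma ⟨1, le_rfl, h⟩) :=
  lift_tauOne _ _ _

end

/-- The homomorphism `SG_n →* B_n` that sends `σ_i` to `σ_i` and `τ_1` to `σ_1`. -/
def toBraid (n : ℕ) : SingularBraidGroup n →* BraidGroup n :=
  liftTwist (MonoidHom.id _) (fun _ ↦ 1) (fun _ _ _ ↦ .one_left _) (fun _ ↦ .one_left _)
    (fun _ _ _ ↦ .one_left _)

@[simp]
theorem toBraid_sigma (i : BraidIndex n) : toBraid n (sigma i) = BraidGroup.sigma i :=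
  liftTwist_sigma _ _ _ _ _ i

@[simp]
theorem toBraid_tauOne (h : 1 < n) :
    toBraid n (tauOne h) = BraidGroup.sigma ⟨1, le_rfl, h⟩ :=
  (liftTwist_tauOne _ _ _ _ _ h).trans (one_mul _)

/-- The singular braid group embeds in a semidirect product of a right-angled Artin group with the
braid group; `τ_1` goes to the generator attached to the twist `τ_1 σ_1⁻¹`, times `σ_1`. -/
theorem torsionFreeGroup (n : ℕ) : TorsionFreeGroup (SingularBraidGroup n) := by
  let R : SingularBraidGroup n → SingularBraidGroup n → Prop := Commute
  have hR : ∀ g a b, R a b → R (g * a * g⁻¹) (g * b * g⁻¹) := fun g a b h ↦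
    (Commute.conj_iff g).2 h
  have hcomm : ∀ a b, R a b → Commute a b := fun _ _ h ↦ h
  have hfix : ∀ (h : 1 < n) (b : BraidGroup n), Commute (twist h) (ofBraid n b) →
      Commute (SemidirectProduct.inl (.of R (twist h)) :
        RightAngledArtinGroup R ⋊[(RightAngledArtinGroup.conj R hR).comp (ofBraid n)] BraidGroup n)
        (SemidirectProduct.inr b) := by
    intro h b hb
    have h1 : ofBraid n b * twist h * (ofBraid n b)⁻¹ = twist h := by
      rw [← hb.eq, mul_inv_cancel_right]
    change SemidirectProduct.inl _ * SemidirectProduct.inr _ =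
      SemidirectProduct.inr _ * SemidirectProduct.inl _
    ext <;> simp [h1]
  let f : SingularBraidGroup n →*
      RightAngledArtinGroup R ⋊[(RightAngledArtinGroup.conj R hR).comp (ofBraid n)] BraidGroup n :=
    liftTwist SemidirectProduct.inr (fun h ↦
      SemidirectProduct.inl (.of R (twist h)))
      (fun h i hi ↦ hfix h _ (by simpa using commute_twist_sigma h i hi))
      (fun h ↦ hfix _ _ (by simpa using commute_twist_wordA h))
      (fun h B hB ↦ by
        rw [hB, ← map_inv, ← SemidirectProduct.inl_aut]
        refine Commute.map ?_ SemidirectProduct.inl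
        simp only [MonoidHom.comp_apply, RightAngledArtinGroup.conj_of]
        exact RightAngledArtinGroup.commute_of (by simpa using commute_twist_conj_wordB h))
  have hsec : (RightAngledArtinGroup.evalSemidirect hR hcomm (ofBraid n)).comp f = MonoidHom.id _ :=
    hom_ext (fun i ↦ by simp [f, RightAngledArtinGroup.evalSemidirect_apply])
      (fun h ↦ by simp [f, RightAngledArtinGroup.evalSemidirect_apply, twist_mul_sigma])
  have hright : SemidirectProduct.rightHom.comp f = toBraid n :=
    hom_ext (fun i ↦ by simp [f]) (fun h ↦ by simp [f])
  intro g hg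
  refine RightAngledArtinGroup.eq_one_of_right_eq_one hR hcomm
    (RightAngledArtinGroup.torsionFreeGroup R) (ofBraid n) f (DFunLike.congr_fun hsec) hg ?_
  exact BraidGroup.torsionFreeGroup n _ ((SemidirectProduct.rightHom.comp f).isOfFinOrder hg)

theorem N_le_ker_toBraid : N n ≤ (toBraid n).ker := by
  refine Subgroup.normalClosure_le_normal ?_
  rintro _ ⟨h, rfl⟩
  simp [MonoidHom.mem_ker]

/-- The quotient of the singular braid group by `N` is the braid group. -/
def quotientEquiv (n : ℕ) : (SingularBraidGroup n ⧸ N n) ≃* BraidGroup n :=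
  MonoidHom.toMulEquiv
    (QuotientGroup.lift (N n) (toBraid n) N_le_ker_toBraid)
    ((QuotientGroup.mk' (N n)).comp (ofBraid n))
    (by
      refine QuotientGroup.monoidHom_ext _ (hom_ext (fun i ↦ by simp) fun h ↦ ?_)
      simp only [MonoidHom.comp_apply, QuotientGroup.mk'_apply, QuotientGroup.lift_mk,
        toBraid_tauOne, ofBraid_sigma, MonoidHom.id_apply]
      rw [QuotientGroup.eq_iff_div_mem, ← inv_mem_iff, inv_div, div_eq_mul_inv]
      exact Subgroup.subset_normalClosure ⟨h, rfl⟩)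
    (PresentedGroup.ext fun i ↦ by
      change toBraid n (ofBraid n (BraidGroup.sigma i)) = BraidGroup.sigma i
      simp)

end SingularBraidGroup

theorem mainTheorem4 (n : ℕ) :
    TorsionFreeGroup (SingularBraidGroup n) ∧
    TorsionFreeGroup (BraidGroup n) ∧
    ∃ e : (SingularBraidGroup n ⧸ SingularBraidGroup.N n) ≃* BraidGroup n,
      (∀ i : BraidIndex n,
        e (QuotientGroup.mk (SingularBraidGroup.sigma i)) = BraidGroup.sigma i) ∧
      (∀ h : 1 < n,
        e (QuotientGroup.mk (SingularBraidGroup.tauOne h)) =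
          BraidGroup.sigma ⟨1, le_rfl, h⟩) :=
  ⟨SingularBraidGroup.torsionFreeGroup n, BraidGroup.torsionFreeGroup n,
    SingularBraidGroup.quotientEquiv n, SingularBraidGroup.toBraid_sigma,
    SingularBraidGroup.toBraid_tauOne⟩
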